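/- Write $(q)_n := \prod_{i=1}^{n} (1-q^i)$. For every complex number $q$ with $|q|<1$, the denominators below are non-zero, both series converge absolutely, and \[ \sum_{n\geq 1} (-1)^n q^{n^2} = \sum_{n\geq 1} \frac{(-1)^n q^{n(n+1)/2}}{(q)_n (1+q^n)}. \] The same identity holds for a formal variable $q$ in the ring $\mathbb{Z}[[q]]$ of formal power series, where the denominators are invertible and both series converge coefficientwise. -/

import Mathlib

open scoped PowerSeries.WithPiTopology

/-- The finite `q`-Pochhammer symbol `(a; q)_n = (1 - a)(1 - a q) ⋯ (1 - a q ^ (n - 1))`. -/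
def qPochhammer {R : Type*} [CommRing R] (a q : R) (n : ℕ) : R :=
  ∏ i ∈ Finset.range n, (1 - a * q ^ i)

/-!
Both series are limits, as `N → ∞`, of finite sums that agree for every `N`. Put
`v N k = ∏_{i < k} (1 - q ^ (N - i))`. Then (`sum_square_eq_sum_triangular`)

`∑_{k=1}^N (-1)^k q^(k^2) v N k / (q^(N+1); q)_k`
  `= ∑_{k=1}^N (-1)^k q^(k(k+1)/2) v N k / ((q)_k (1 + q^k))`.

Writing `S N` for either of the two sums, `1 + 2 S N` is equal to `(q)_N / (-q; q)_N`. For the left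
side this is a finite form of Gauss's theta identity, for the right side the partial fraction
expansion of `(q)_N / (x; q)_{N+1}` at `x = -1`. Both are proved by checking the recursion
`(1 + q^(N+1)) (1 + 2 S (N+1)) = (1 - q^(N+1)) (1 + 2 S N)`. The difference of its two sides, with
the sums cut off at `k ≤ K`, telescopes to an explicit multiple of `v N K`
(`triangular_partial_sum` and `square_partial_sum`), which vanishes for `K = N + 1`.

For fixed `k` the factors `v N k` and `(q^(N+1); q)_k` tend to `1`. For complex `q` both are
controlled by `k`-th powers of constants, which the decay of `q^(k(k+1)/2)` absorbs, so Tannery's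
theorem gives the limit. For formal `q` the `k`-th term is divisible by `q^k`, and replacing the
factors by `1` changes it only by multiples of `q^k q^(N+1-k)`; hence modulo `q^(N+1)` the finite
identity is the identity of the partial sums.
-/

/-! ### The finite identity -/

/-- The product `(1 - q ^ N) (1 - q ^ (N - 1)) ⋯ (1 - q ^ (N - k + 1))`, that is
`(q)_N / (q)_(N - k)` for `k ≤ N`. The truncated subtraction in the exponent makes it vanish for
`k > N`, as it should, since the factor with `i = N` is `1 - q ^ 0`. -/
def qFalling {R : Type*} [CommRing R] (q : R) (N k : ℕ) : R :=
  ∏ i ∈ Finset.range k, (1 - q ^ (N - i))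

theorem qFalling_succ {R : Type*} [CommRing R] (q : R) (N k : ℕ) :
    qFalling q N (k + 1) = qFalling q N k * (1 - q ^ (N - k)) :=
  Finset.prod_range_succ _ _

theorem qFalling_succ_succ {R : Type*} [CommRing R] (q : R) (N k : ℕ) :
    qFalling q (N + 1) (k + 1) = (1 - q ^ (N + 1)) * qFalling q N k := by
  simp [qFalling, Finset.prod_range_succ', mul_comm]

theorem qFalling_eq_zero {R : Type*} [CommRing R] (q : R) {N k : ℕ} (h : N < k) :
    qFalling q N k = 0 :=
  Finset.prod_eq_zero (Finset.mem_range.2 h) (by simp)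

theorem qPochhammer_succ {R : Type*} [CommRing R] (a q : R) (k : ℕ) :
    qPochhammer a q (k + 1) = qPochhammer a q k * (1 - a * q ^ k) :=
  Finset.prod_range_succ _ _

theorem qPochhammer_succ' {R : Type*} [CommRing R] (a q : R) (k : ℕ) :
    qPochhammer a q (k + 1) = (1 - a) * qPochhammer (a * q) q k := by
  simp only [qPochhammer, Finset.prod_range_succ', pow_zero, mul_one, pow_succ']
  rw [mul_comm]
  simp only [mul_assoc]

theorem qPochhammer_ne_zero {K : Type*} [Field K] {q : K} (hm : ∀ n : ℕ, 1 - q ^ (n + 1) ≠ 0)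
    (N k : ℕ) : qPochhammer (q ^ (N + 1)) q k ≠ 0 := by
  refine Finset.prod_ne_zero_iff.2 fun i _ => ?_
  have := hm (N + i)
  rwa [show N + i + 1 = N + 1 + i by ring, pow_add] at this

theorem triangle_succ (k : ℕ) : (k + 1) * (k + 1 + 1) / 2 = k * (k + 1) / 2 + (k + 1) := by
  rw [show (k + 1) * (k + 1 + 1) = k * (k + 1) + (k + 1) * 2 by ring,
    Nat.add_mul_div_right _ _ two_pos]

/-- Splits off the contribution of the last terms `u` and `v` of two sums in the recursion. -/
theorem one_add_two_mul_sub_one_add_two_mul {R : Type*} [CommRing R] (a b s t u v : R) :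
    a * (1 + 2 * (s + u)) - b * (1 + 2 * (t + v)) =
      a * (1 + 2 * s) - b * (1 + 2 * t) + 2 * (a * u - b * v) := by
  ring

section Field

variable {K : Type*} [Field K] {q : K}

/-- The defect in the recursion for the finite triangular sums, when they are cut off after `k`
terms. At `k = N + 1` it vanishes because `qFalling q N (N + 1) = 0`. -/
theorem triangular_partial_sum (hm : ∀ n : ℕ, 1 - q ^ (n + 1) ≠ 0)
    (hp : ∀ n : ℕ, 1 + q ^ (n + 1) ≠ 0) (N k : ℕ) (hk : k ≤ N + 1) :
    (1 + q ^ (N + 1)) * (1 + 2 * ∑ j ∈ Finset.range k,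
        (-1) ^ (j + 1) * q ^ ((j + 1) * (j + 1 + 1) / 2) /
          (qPochhammer q q (j + 1) * (1 + q ^ (j + 1))) * qFalling q (N + 1) (j + 1)) -
      (1 - q ^ (N + 1)) * (1 + 2 * ∑ j ∈ Finset.range k,
        (-1) ^ (j + 1) * q ^ ((j + 1) * (j + 1 + 1) / 2) /
          (qPochhammer q q (j + 1) * (1 + q ^ (j + 1))) * qFalling q N (j + 1)) =
      2 * (-1) ^ k * q ^ (k * (k + 1) / 2 + N + 1) * qFalling q N k / qPochhammer q q k := by
  induction k with
  | zero => simp [qFalling, qPochhammer]; ring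
  | succ k ih =>
    specialize ih (by omega)
    -- The closed form contains `q ^ (N - k)`: with `N = k + m` the subtraction disappears.
    obtain ⟨m, rfl⟩ : ∃ m, N = k + m := ⟨N - k, by omega⟩
    have h0 : qPochhammer q q k ≠ 0 := by simpa using qPochhammer_ne_zero hm 0 k
    have h1 := hm k
    have h2 := hp k
    rw [Finset.sum_range_succ, Finset.sum_range_succ]
    simp only [qFalling_succ_succ, qFalling_succ q (k + m), qPochhammer_succ, triangle_succ,
      ← pow_succ', Nat.add_sub_cancel_left] at ih ⊢
    rw [one_add_two_mul_sub_one_add_two_mul, ih]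
    field_simp
    ring

/-- The defect in the recursion for the finite sums over squares, when they are cut off after `k`
terms. At `k = N + 1` it vanishes because `qFalling q N (N + 1) = 0`. -/
theorem square_partial_sum (hm : ∀ n : ℕ, 1 - q ^ (n + 1) ≠ 0) (N k : ℕ) (hk : k ≤ N + 1) :
    (1 + q ^ (N + 1)) * (1 + 2 * ∑ j ∈ Finset.range k, (-1) ^ (j + 1) * q ^ ((j + 1) ^ 2) *
        (qFalling q (N + 1) (j + 1) / qPochhammer (q ^ (N + 1 + 1)) q (j + 1))) -
      (1 - q ^ (N + 1)) * (1 + 2 * ∑ j ∈ Finset.range k, (-1) ^ (j + 1) * q ^ ((j + 1) ^ 2) *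
        (qFalling q N (j + 1) / qPochhammer (q ^ (N + 1)) q (j + 1))) =
      2 * (-1) ^ k * q ^ (k ^ 2 + k + N + 1) * qFalling q N k /
        qPochhammer (q ^ (N + 1 + 1)) q k := by
  induction k with
  | zero => simp [qFalling, qPochhammer]; ring
  | succ k ih =>
    specialize ih (by omega)
    -- The closed form contains `q ^ (N - k)`: with `N = k + m` the subtraction disappears.
    obtain ⟨m, rfl⟩ : ∃ m, N = k + m := ⟨N - k, by omega⟩
    have h0 := qPochhammer_ne_zero hm (k + m + 1) k
    have h1 := hm (k + m)
    have h2 : 1 - q ^ (k + m + 1 + 1) * q ^ k ≠ 0 := by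
      rw [← pow_add]; simpa [add_right_comm] using hm (k + m + 1 + k)
    rw [Finset.sum_range_succ, Finset.sum_range_succ,
      one_add_two_mul_sub_one_add_two_mul, ih]
    rw [qPochhammer_succ' (q ^ (k + m + 1)), ← pow_succ, qPochhammer_succ, qFalling_succ_succ,
      qFalling_succ, Nat.add_sub_cancel_left]
    generalize qPochhammer (q ^ (k + m + 1 + 1)) q k = P at *
    field_simp
    ring

/-- The finite form of the identity: both sides satisfy the same first-order recursion in `N`. -/
theorem sum_square_eq_sum_triangular (hm : ∀ n : ℕ, 1 - q ^ (n + 1) ≠ 0)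
    (hp : ∀ n : ℕ, 1 + q ^ (n + 1) ≠ 0) (h2 : (2 : K) ≠ 0) (N : ℕ) :
    ∑ j ∈ Finset.range N, (-1) ^ (j + 1) * q ^ ((j + 1) ^ 2) *
        (qFalling q N (j + 1) / qPochhammer (q ^ (N + 1)) q (j + 1)) =
      ∑ j ∈ Finset.range N, (-1) ^ (j + 1) * q ^ ((j + 1) * (j + 1 + 1) / 2) /
          (qPochhammer q q (j + 1) * (1 + q ^ (j + 1))) * qFalling q N (j + 1) := by
  induction N with
  | zero => simp
  | succ N ih =>
    have hA := triangular_partial_sum hm hp N (N + 1) le_rfl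
    have hB := square_partial_sum hm N (N + 1) le_rfl
    rw [qFalling_eq_zero q N.lt_succ_self, mul_zero, zero_div] at hA hB
    rw [Finset.sum_range_succ (fun j => _ * qFalling q N (j + 1)),
      qFalling_eq_zero q N.lt_succ_self, mul_zero, add_zero, ← ih] at hA
    rw [Finset.sum_range_succ (fun j => _ * (qFalling q N (j + 1) / _)),
      qFalling_eq_zero q N.lt_succ_self, zero_div, mul_zero, add_zero] at hB
    refine mul_left_cancel₀ (mul_ne_zero (hp N) h2) ?_
    linear_combination hB - hA

end Field

/-! ### Complex `q` in the unit disc -/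

section Complex
open Filter Topology

variable {q : ℂ}

theorem norm_qFalling_le (hq : ‖q‖ < 1) (N k : ℕ) : ‖qFalling q N k‖ ≤ 2 ^ k := by
  calc ‖qFalling q N k‖ ≤ ∏ _i ∈ Finset.range k, (2 : ℝ) := by
        rw [qFalling, norm_prod]
        refine Finset.prod_le_prod (fun _ _ => norm_nonneg _) fun i _ => ?_
        refine (norm_sub_le _ _).trans ?_
        rw [norm_one, norm_pow]
        linarith [pow_le_one₀ (n := N - i) (norm_nonneg q) hq.le]
    _ = 2 ^ k := by simp

theorem one_sub_norm_le (hq : ‖q‖ < 1) (n : ℕ) : 1 - ‖q‖ ≤ 1 - ‖q ^ (n + 1)‖ := by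
  rw [norm_pow]
  exact sub_le_sub_left (pow_le_of_le_one (norm_nonneg q) hq.le n.succ_ne_zero) 1

theorem one_sub_norm_le_norm_one_sub_pow (hq : ‖q‖ < 1) (n : ℕ) :
    1 - ‖q‖ ≤ ‖1 - q ^ (n + 1)‖ :=
  (one_sub_norm_le hq n).trans (by simpa using norm_sub_norm_le 1 (q ^ (n + 1)))

theorem one_sub_norm_le_norm_one_add_pow (hq : ‖q‖ < 1) (n : ℕ) :
    1 - ‖q‖ ≤ ‖1 + q ^ (n + 1)‖ :=
  (one_sub_norm_le hq n).trans (by simpa using norm_sub_norm_le 1 (-q ^ (n + 1)))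

theorem pow_le_norm_qPochhammer (hq : ‖q‖ < 1) (N k : ℕ) :
    (1 - ‖q‖) ^ k ≤ ‖qPochhammer (q ^ (N + 1)) q k‖ := by
  calc (1 - ‖q‖) ^ k = ∏ _i ∈ Finset.range k, (1 - ‖q‖) := by simp
    _ ≤ _ := by
        rw [qPochhammer, norm_prod]
        refine Finset.prod_le_prod (fun _ _ => by linarith) fun i _ => ?_
        rw [← pow_add, add_right_comm]
        exact one_sub_norm_le_norm_one_sub_pow hq _

theorem tendsto_qFalling (hq : ‖q‖ < 1) (k : ℕ) :
    Tendsto (fun N => qFalling q N k) atTop (𝓝 1) := by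
  have h : ∀ i ∈ Finset.range k, Tendsto (fun N => 1 - q ^ (N - i)) atTop (𝓝 1) := fun i _ => by
    simpa using ((tendsto_pow_atTop_nhds_zero_of_norm_lt_one hq).comp
      (tendsto_sub_atTop_nat i)).const_sub 1
  simpa [qFalling] using tendsto_finsetProd _ h

theorem tendsto_qPochhammer (hq : ‖q‖ < 1) (k : ℕ) :
    Tendsto (fun N => qPochhammer (q ^ (N + 1)) q k) atTop (𝓝 1) := by
  have h : ∀ i ∈ Finset.range k,
      Tendsto (fun N => 1 - q ^ (N + 1) * q ^ i) atTop (𝓝 1) := fun i _ => by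
    simpa using (((tendsto_pow_atTop_nhds_zero_of_norm_lt_one hq).comp
      (tendsto_add_atTop_nat 1)).mul_const (q ^ i)).const_sub 1
  simpa [qPochhammer] using tendsto_finsetProd _ h

/-- The common majorant: `r ^ (n (n + 1) / 2)` decays faster than any geometric sequence grows. -/
theorem summable_pow_triangle_mul_pow {r : ℝ} (hr0 : 0 ≤ r) (hr : r < 1) (C : ℝ) :
    Summable fun n : ℕ => r ^ ((n + 1) * (n + 1 + 1) / 2) * C ^ (n + 1) := by
  have hlim : Tendsto (fun n : ℕ => r ^ (n + 1 + 1) * |C|) atTop (𝓝 0) := by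
    simpa using (((tendsto_pow_atTop_nhds_zero_of_lt_one hr0 hr).comp
      (tendsto_add_atTop_nat 2)).mul_const |C|)
  refine summable_of_ratio_norm_eventually_le (r := 1 / 2) (by norm_num) ?_
  filter_upwards [hlim.eventually (ge_mem_nhds (show (0 : ℝ) < 1 / 2 by norm_num))] with n hn
  rw [triangle_succ (n + 1), pow_add, pow_succ C (n + 1)]
  calc _ = r ^ (n + 1 + 1) * |C| * ‖r ^ ((n + 1) * (n + 1 + 1) / 2) * C ^ (n + 1)‖ := by
        simp only [norm_mul, norm_pow, Real.norm_eq_abs, abs_of_nonneg hr0]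
        ring
    _ ≤ _ := mul_le_mul_of_nonneg_right hn (norm_nonneg _)

theorem norm_square_term_le (hq : ‖q‖ < 1) (k : ℕ) :
    ‖(-1) ^ (k + 1) * q ^ ((k + 1) ^ 2)‖ ≤ ‖q‖ ^ ((k + 1) * (k + 1 + 1) / 2) := by
  rw [norm_mul, norm_pow, norm_pow, norm_neg, norm_one, one_pow, one_mul]
  exact pow_le_pow_of_le_one (norm_nonneg q) hq.le (Nat.div_le_of_le_mul (by nlinarith))

theorem norm_triangular_term_le (hq : ‖q‖ < 1) (k : ℕ) :
    ‖(-1) ^ (k + 1) * q ^ ((k + 1) * (k + 1 + 1) / 2) /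
      (qPochhammer q q (k + 1) * (1 + q ^ (k + 1)))‖ ≤
      ‖q‖ ^ ((k + 1) * (k + 1 + 1) / 2) * (1 / (1 - ‖q‖) ^ 2) ^ (k + 1) := by
  have hr : 0 < 1 - ‖q‖ := by linarith
  have h1 : (1 - ‖q‖) ^ (k + 1) ≤ ‖qPochhammer q q (k + 1)‖ := by
    simpa using pow_le_norm_qPochhammer hq 0 (k + 1)
  have h2 : (1 - ‖q‖) ^ (k + 1) ≤ ‖1 + q ^ (k + 1)‖ :=
    (pow_le_of_le_one hr.le (by linarith [norm_nonneg q]) k.succ_ne_zero).trans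
      (one_sub_norm_le_norm_one_add_pow hq k)
  rw [norm_div, norm_mul, norm_pow, norm_pow, norm_neg, norm_one, one_pow, one_mul, norm_mul,
    one_div, inv_pow, ← div_eq_mul_inv, ← pow_mul, mul_comm 2, pow_mul, sq]
  gcongr

theorem summable_square_term (hq : ‖q‖ < 1) :
    Summable fun k : ℕ => (-1) ^ (k + 1) * q ^ ((k + 1) ^ 2) :=
  .of_norm_bounded (by simpa using summable_pow_triangle_mul_pow (norm_nonneg q) hq 1)
    (norm_square_term_le hq)

theorem summable_triangular_term (hq : ‖q‖ < 1) :
    Summable fun k : ℕ => (-1) ^ (k + 1) * q ^ ((k + 1) * (k + 1 + 1) / 2) /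
      (qPochhammer q q (k + 1) * (1 + q ^ (k + 1))) :=
  .of_norm_bounded (summable_pow_triangle_mul_pow (norm_nonneg q) hq _)
    (norm_triangular_term_le hq)

theorem tsum_square_eq_tsum_triangular (hq : ‖q‖ < 1) :
    ∑' k : ℕ, (-1) ^ (k + 1) * q ^ ((k + 1) ^ 2) =
      ∑' k : ℕ, (-1) ^ (k + 1) * q ^ ((k + 1) * (k + 1 + 1) / 2) /
        (qPochhammer q q (k + 1) * (1 + q ^ (k + 1))) := by
  have hr : 0 < 1 - ‖q‖ := by linarith
  have hm (n : ℕ) : 1 - q ^ (n + 1) ≠ 0 :=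
    norm_pos_iff.1 (hr.trans_le (one_sub_norm_le_norm_one_sub_pow hq n))
  have hp (n : ℕ) : 1 + q ^ (n + 1) ≠ 0 :=
    norm_pos_iff.1 (hr.trans_le (one_sub_norm_le_norm_one_add_pow hq n))
  have hA := tendsto_tsum_of_dominated_convergence
    (f := fun N k => (-1) ^ (k + 1) * q ^ ((k + 1) ^ 2) *
      (qFalling q N (k + 1) / qPochhammer (q ^ (N + 1)) q (k + 1)))
    (summable_pow_triangle_mul_pow (norm_nonneg q) hq (2 / (1 - ‖q‖)))
    (fun k => ((tendsto_qFalling hq (k + 1)).div (tendsto_qPochhammer hq (k + 1))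
      one_ne_zero).const_mul ((-1) ^ (k + 1) * q ^ ((k + 1) ^ 2)))
    (.of_forall fun N k => by
      rw [norm_mul, norm_div, div_pow]
      gcongr
      · exact norm_square_term_le hq k
      · exact norm_qFalling_le hq N (k + 1)
      · exact pow_le_norm_qPochhammer hq N (k + 1))
  have hB := tendsto_tsum_of_dominated_convergence
    (f := fun N k => (-1) ^ (k + 1) * q ^ ((k + 1) * (k + 1 + 1) / 2) /
      (qPochhammer q q (k + 1) * (1 + q ^ (k + 1))) * qFalling q N (k + 1))
    (summable_pow_triangle_mul_pow (norm_nonneg q) hq (1 / (1 - ‖q‖) ^ 2 * 2))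
    (fun k => (tendsto_qFalling hq (k + 1)).const_mul
      ((-1) ^ (k + 1) * q ^ ((k + 1) * (k + 1 + 1) / 2) /
        (qPochhammer q q (k + 1) * (1 + q ^ (k + 1)))))
    (.of_forall fun N k => by
      rw [norm_mul, mul_pow, ← mul_assoc]
      gcongr
      · exact norm_triangular_term_le hq k
      · exact norm_qFalling_le hq N (k + 1))
  simp only [div_one, mul_one] at hA hB
  refine tendsto_nhds_unique hA (hB.congr fun N => ?_)
  rw [tsum_eq_sum (s := Finset.range N), tsum_eq_sum (s := Finset.range N)]
  · exact (sum_square_eq_sum_triangular hm hp two_ne_zero N).symm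
  all_goals
    intro k hk
    rw [qFalling_eq_zero q (by simpa [Nat.lt_succ_iff] using hk)]
    simp

end Complex

/-! ### Formal `q` -/

section Formal
open PowerSeries

theorem pow_dvd_qFalling_sub_one {R : Type*} [CommRing R] (q : R) (N k : ℕ) :
    q ^ (N + 1 - k) ∣ qFalling q N k - 1 := by
  induction k with
  | zero => simp [qFalling]
  | succ k ih =>
    rw [qFalling_succ, show qFalling q N k * (1 - q ^ (N - k)) - 1 =
      (qFalling q N k - 1) - q ^ (N - k) * qFalling q N k by ring, Nat.add_sub_add_right]
    exact dvd_sub ((pow_dvd_pow q (by omega)).trans ih) (dvd_mul_right _ _)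

theorem dvd_qPochhammer_sub_one {R : Type*} [CommRing R] (a q : R) (k : ℕ) :
    a ∣ qPochhammer a q k - 1 := by
  induction k with
  | zero => simp [qPochhammer]
  | succ k ih =>
    rw [qPochhammer_succ, show qPochhammer a q k * (1 - a * q ^ k) - 1 =
      (qPochhammer a q k - 1) - a * (q ^ k * qPochhammer a q k) by ring]
    exact dvd_sub ih (dvd_mul_right _ _)

theorem isUnit_qPochhammer_X {N : ℕ} (k : ℕ) :
    IsUnit (qPochhammer ((X : ℤ⟦X⟧) ^ (N + 1)) X k) := by
  simp [isUnit_iff_constantCoeff, qPochhammer]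

theorem isUnit_one_add_X_pow (k : ℕ) : IsUnit (1 + (X : ℤ⟦X⟧) ^ (k + 1)) := by
  simp [isUnit_iff_constantCoeff]

theorem isUnit_denominator_X (k : ℕ) :
    IsUnit (qPochhammer (X : ℤ⟦X⟧) X (k + 1) * (1 + X ^ (k + 1))) := by
  simpa using (isUnit_qPochhammer_X (N := 0) (k + 1)).mul (isUnit_one_add_X_pow k)

theorem map_ringInverse_of_isUnit {R K : Type*} [CommRing R] [Field K] (φ : R →+* K) {a : R}
    (ha : IsUnit a) : φ (Ring.inverse a) = (φ a)⁻¹ :=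
  eq_inv_of_mul_eq_one_left (by rw [← map_mul, Ring.inverse_mul_cancel a ha, map_one])

/-- The finite identity in `ℤ⟦X⟧`, obtained from its fraction field. -/
theorem sum_square_eq_sum_triangular_X (N : ℕ) :
    ∑ j ∈ Finset.range N, (-1) ^ (j + 1) * (X : ℤ⟦X⟧) ^ ((j + 1) ^ 2) *
        (qFalling X N (j + 1) * Ring.inverse (qPochhammer (X ^ (N + 1)) X (j + 1))) =
      ∑ j ∈ Finset.range N, (-1) ^ (j + 1) * X ^ ((j + 1) * (j + 1 + 1) / 2) *
        Ring.inverse (qPochhammer X X (j + 1) * (1 + X ^ (j + 1))) * qFalling X N (j + 1) := by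
  have hinj := FaithfulSMul.algebraMap_injective ℤ⟦X⟧ (FractionRing ℤ⟦X⟧)
  have hu (n : ℕ) : IsUnit (1 - (X : ℤ⟦X⟧) ^ (n + 1)) := by simp [isUnit_iff_constantCoeff]
  have h2 : (2 : FractionRing ℤ⟦X⟧) ≠ 0 := by
    have h : (2 : ℤ⟦X⟧) ≠ 0 := fun h =>
      two_ne_zero (α := ℤ) (by rw [← map_ofNat (constantCoeff (R := ℤ)) 2, h, map_zero])
    rw [← map_ofNat (algebraMap ℤ⟦X⟧ (FractionRing ℤ⟦X⟧)) 2]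
    exact (map_ne_zero_iff _ hinj).2 h
  have h := sum_square_eq_sum_triangular (q := algebraMap ℤ⟦X⟧ (FractionRing ℤ⟦X⟧) X)
    (fun n => by simpa using ((hu n).map (algebraMap ℤ⟦X⟧ (FractionRing ℤ⟦X⟧))).ne_zero)
    (fun n => by
      simpa using ((isUnit_one_add_X_pow n).map (algebraMap ℤ⟦X⟧ (FractionRing ℤ⟦X⟧))).ne_zero)
    h2 N
  apply hinj
  simp only [map_sum, map_mul, map_ringInverse_of_isUnit _ (isUnit_denominator_X _),
    map_ringInverse_of_isUnit _ (isUnit_qPochhammer_X _)]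
  simpa [qFalling, qPochhammer, div_eq_mul_inv] using h

/-- If `X ^ (j + 1)` divides the `j`-th term, only the first `d` terms contribute to the coefficient
of `X ^ d`, so the series converges whatever the topology of `R`. -/
theorem hasSum_of_X_pow_dvd {R : Type*} [CommRing R] [TopologicalSpace R] {f : ℕ → R⟦X⟧}
    (hf : ∀ j, X ^ (j + 1) ∣ f j) :
    HasSum f (mk fun d => coeff d (∑ j ∈ Finset.range d, f j)) := by
  rw [PowerSeries.WithPiTopology.hasSum_iff_hasSum_coeff]
  intro d
  rw [coeff_mk, map_sum]
  refine hasSum_sum_of_ne_finset_zero fun j hj => ?_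
  exact X_pow_dvd_iff.1 (hf j) d (by simpa [Nat.lt_succ_iff] using hj)

/-- Factors `g j` that are close to `1` do not change the sum modulo `X ^ (N + 1)`. -/
theorem X_pow_dvd_sum_sub_sum {R : Type*} [CommRing R] {f g : ℕ → R⟦X⟧} {N : ℕ}
    (hf : ∀ j, X ^ (j + 1) ∣ f j) (hg : ∀ j < N, (X : R⟦X⟧) ^ (N - j) ∣ g j - 1) :
    X ^ (N + 1) ∣ ∑ j ∈ Finset.range N, f j * g j - ∑ j ∈ Finset.range N, f j := by
  rw [← Finset.sum_sub_distrib]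
  refine Finset.dvd_sum fun j hj => ?_
  have hj := Finset.mem_range.1 hj
  rw [show f j * g j - f j = f j * (g j - 1) by ring, show N + 1 = j + 1 + (N - j) by omega,
    pow_add]
  exact mul_dvd_mul (hf j) (hg j hj)

theorem X_pow_dvd_square_term (j : ℕ) :
    (X : ℤ⟦X⟧) ^ (j + 1) ∣ (-1) ^ (j + 1) * X ^ ((j + 1) ^ 2) :=
  (pow_dvd_pow X (by nlinarith)).mul_left _

theorem X_pow_dvd_triangular_term (j : ℕ) :
    (X : ℤ⟦X⟧) ^ (j + 1) ∣ (-1) ^ (j + 1) * X ^ ((j + 1) * (j + 1 + 1) / 2) *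
      Ring.inverse (qPochhammer X X (j + 1) * (1 + X ^ (j + 1))) :=
  ((pow_dvd_pow X (triangle_succ j ▸ Nat.le_add_left _ _)).mul_left _).mul_right _

theorem coeff_sum_square_eq_coeff_sum_triangular (d : ℕ) :
    coeff d (∑ j ∈ Finset.range d, (-1) ^ (j + 1) * (X : ℤ⟦X⟧) ^ ((j + 1) ^ 2)) =
      coeff d (∑ j ∈ Finset.range d, (-1) ^ (j + 1) * X ^ ((j + 1) * (j + 1 + 1) / 2) *
        Ring.inverse (qPochhammer X X (j + 1) * (1 + X ^ (j + 1)))) := by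
  have hv (j : ℕ) : (X : ℤ⟦X⟧) ^ (d - j) ∣ qFalling X d (j + 1) - 1 := by
    simpa using pow_dvd_qFalling_sub_one (X : ℤ⟦X⟧) d (j + 1)
  have hw (j : ℕ) : (X : ℤ⟦X⟧) ^ (d - j) ∣ qFalling X d (j + 1) *
      Ring.inverse (qPochhammer (X ^ (d + 1)) X (j + 1)) - 1 := by
    rw [← Ring.mul_inverse_cancel _ (isUnit_qPochhammer_X (N := d) (j + 1)), ← sub_mul,
      ← sub_sub_sub_cancel_right _ _ 1]
    exact (dvd_sub (hv j) ((pow_dvd_pow X (by omega)).trans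
      (dvd_qPochhammer_sub_one _ _ _))).mul_right _
  have hA := X_pow_dvd_sum_sub_sum X_pow_dvd_square_term fun j (_ : j < d) => hw j
  have hB := X_pow_dvd_sum_sub_sum X_pow_dvd_triangular_term fun j (_ : j < d) => hv j
  -- The weighted sums agree, so the difference of the two errors is that of the plain sums.
  have h := X_pow_dvd_iff.1 (dvd_sub hA hB) d d.lt_succ_self
  rw [sum_square_eq_sum_triangular_X, sub_sub_sub_cancel_left, map_sub, sub_eq_zero] at h
  exact h.symm

end Formal

/-! ### The two identities -/

theorem corollary3 :
    (∀ q : ℂ, ‖q‖ < 1 →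
      (∀ n : ℕ+, qPochhammer q q n * (1 + q ^ (n : ℕ)) ≠ 0) ∧
      Summable (fun n : ℕ+ => (-1) ^ (n : ℕ) * q ^ ((n : ℕ) ^ 2)) ∧
      Summable (fun n : ℕ+ => (-1) ^ (n : ℕ) * q ^ ((n : ℕ) * ((n : ℕ) + 1) / 2) /
        (qPochhammer q q n * (1 + q ^ (n : ℕ)))) ∧
      ∑' n : ℕ+, (-1) ^ (n : ℕ) * q ^ ((n : ℕ) ^ 2) =
        ∑' n : ℕ+, (-1) ^ (n : ℕ) * q ^ ((n : ℕ) * ((n : ℕ) + 1) / 2) /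
          (qPochhammer q q n * (1 + q ^ (n : ℕ)))) ∧
    (∀ q : PowerSeries ℤ, q = PowerSeries.X →
      (∀ n : ℕ+, IsUnit (qPochhammer q q n * (1 + q ^ (n : ℕ)))) ∧
      Summable (fun n : ℕ+ => (-1) ^ (n : ℕ) * q ^ ((n : ℕ) ^ 2)) ∧
      Summable (fun n : ℕ+ => (-1) ^ (n : ℕ) * q ^ ((n : ℕ) * ((n : ℕ) + 1) / 2) *
        Ring.inverse (qPochhammer q q n * (1 + q ^ (n : ℕ)))) ∧
      ∑' n : ℕ+, (-1) ^ (n : ℕ) * q ^ ((n : ℕ) ^ 2) =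
        ∑' n : ℕ+, (-1) ^ (n : ℕ) * q ^ ((n : ℕ) * ((n : ℕ) + 1) / 2) *
          Ring.inverse (qPochhammer q q n * (1 + q ^ (n : ℕ)))) := by
  constructor
  · intro q hq
    have hr : 0 < 1 - ‖q‖ := by linarith
    have hA := (hasSum_pnat_iff_hasSum_succ (f := fun n => (-1) ^ n * q ^ (n ^ 2))).2
      (summable_square_term hq).hasSum
    have hB := hasSum_pnat_iff_hasSum_succ
      (f := fun n => (-1) ^ n * q ^ (n * (n + 1) / 2) / (qPochhammer q q n * (1 + q ^ n))).2
      (summable_triangular_term hq).hasSum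
    refine ⟨fun n => ?_, hA.summable, hB.summable, ?_⟩
    · obtain ⟨k, hk⟩ := Nat.exists_eq_add_one_of_ne_zero n.ne_zero
      rw [hk]
      refine mul_ne_zero (norm_pos_iff.1 ?_) (norm_pos_iff.1 ?_)
      · exact (pow_pos hr (k + 1)).trans_le (by simpa using pow_le_norm_qPochhammer hq 0 (k + 1))
      · exact hr.trans_le (one_sub_norm_le_norm_one_add_pow hq k)
    · exact hA.tsum_eq.trans ((tsum_square_eq_tsum_triangular hq).trans hB.tsum_eq.symm)
  · rintro q rfl
    have hA := hasSum_of_X_pow_dvd X_pow_dvd_square_term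
    have hB := hasSum_of_X_pow_dvd X_pow_dvd_triangular_term
    simp only [← coeff_sum_square_eq_coeff_sum_triangular] at hB
    replace hA := (hasSum_pnat_iff_hasSum_succ
      (f := fun n => (-1) ^ n * (PowerSeries.X : PowerSeries ℤ) ^ (n ^ 2))).2 hA
    replace hB := (hasSum_pnat_iff_hasSum_succ
      (f := fun n => (-1) ^ n * (PowerSeries.X : PowerSeries ℤ) ^ (n * (n + 1) / 2) *
        Ring.inverse (qPochhammer PowerSeries.X PowerSeries.X n *
          (1 + PowerSeries.X ^ n)))).2 hB
    refine ⟨fun n => ?_, hA.summable, hB.summable, hA.tsum_eq.trans hB.tsum_eq.symm⟩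
    obtain ⟨k, hk⟩ := Nat.exists_eq_add_one_of_ne_zero n.ne_zero
    rw [hk]
    exact isUnit_denominator_X k
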